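/- Let $n\ge 1$ be an integer, $1\le p<\infty$, and let $f\in W^{1,p}(\mathbb R^n)$ have compact support, with weak gradient $\nabla f$. For an origin-symmetric convex body $K\subset\mathbb R^n$ (a compact convex set with non-empty interior and $K=-K$) let $\|\cdot\|_K$ be the norm with unit ball $K$, and let the polar $L_p$ moment body $Z_p^*K$ be the unit ball of the norm $$\|v\|_{Z_p^*K}=\Big(\frac{n+p}{p}\int_K|v\cdot x|^p\,dx\Big)^{1/p},\qquad v\in\mathbb R^n .$$ Then, for every origin-symmetric convex body $K\subset\mathbb R^n$, $$\lim_{s\to1^-}(1-s)\int_{\mathbb R^n}\int_{\mathbb R^n}\frac{|f(x)-f(y)|^p}{\|x-y\|_K^{n+sp}}\,dx\,dy=\int_{\mathbb R^n}\|\nabla f(x)\|_{Z_p^*K}^p\,dx<\infty .$$ In particular, for the Euclidean norm $|\cdot|$ (that is, for $K$ the Euclidean unit ball) this is the Bourgain–Brezis–Mironescu limit with its constant: for every unit vector $e\in\mathbb R^n$, $$\lim_{s\to1^-}(1-s)\int_{\mathbb R^n}\int_{\mathbb R^n}\frac{|f(x)-f(y)|^p}{|x-y|^{n+sp}}\,dx\,dy=\frac1p\int_{S^{n-1}}|e\cdot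 u|^p\,d\mathcal H^{n-1}(u)\;\int_{\mathbb R^n}|\nabla f(x)|^p\,dx .$$ -/

import Mathlib

open MeasureTheory Filter Topology
open scoped ENNReal ContDiff RealInnerProductSpace

noncomputable section

/-- Euclidean space `ℝⁿ`, with its Euclidean norm, inner product and Lebesgue measure. -/
abbrev Rn (n : ℕ) : Type := EuclideanSpace ℝ (Fin n)

/-- `g` is a weak gradient of `f` on `ℝⁿ`: both are locally integrable and
`∫ f ∂ᵥφ = - ∫ φ ⟨g, v⟩` for all `v ∈ ℝⁿ` and all test functions `φ ∈ C_c^∞(ℝⁿ)`. -/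
def HasWeakGradient {n : ℕ} (f : Rn n → ℝ) (g : Rn n → Rn n) : Prop :=
  LocallyIntegrable f ∧ LocallyIntegrable g ∧
    ∀ φ : Rn n → ℝ, ContDiff ℝ ∞ φ → HasCompactSupport φ →
      ∀ v : Rn n, ∫ x, f x * fderiv ℝ φ x v = - ∫ x, φ x * ⟪g x, v⟫

/-- `f ∈ W^{1,p}(ℝⁿ)`: `f` is in `L^p` and has a weak gradient in `L^p`. -/
def MemW1p {n : ℕ} (p : ℝ) (f : Rn n → ℝ) : Prop :=
  MemLp f (ENNReal.ofReal p) ∧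
    ∃ g : Rn n → Rn n, HasWeakGradient f g ∧ MemLp g (ENNReal.ofReal p)

/-- `f` has compact support as an element of `L^p`: it vanishes almost everywhere outside
some compact set. -/
def HasCompactEssSupport {n : ℕ} (f : Rn n → ℝ) : Prop :=
  ∃ C : Set (Rn n), IsCompact C ∧ ∀ᵐ x, x ∉ C → f x = 0

/-- The `p`-th power `(n+p)/p · ∫_K |v·x|^p dx` of the norm whose unit ball is the polar
`L_p` moment body of `K`. -/
def polarMomentPow {n : ℕ} (p : ℝ) (K : Set (Rn n)) (v : Rn n) : ℝ :=
  ((n : ℝ) + p) / p * ∫ x in K, |⟪v, x⟫| ^ p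

/-- The polar `L_p` moment body of `K`: the unit ball of the norm
`v ↦ ((n+p)/p · ∫_K |v·x|^p dx)^{1/p}`. -/
def polarMomentBody {n : ℕ} (p : ℝ) (K : Set (Rn n)) : Set (Rn n) :=
  {v | polarMomentPow p K v ^ (1 / p) ≤ 1}

/-- The anisotropic Gagliardo double integral
`∫∫ |f(x)-f(y)|^p / ‖x-y‖^{n+sp} dx dy` in `[0,∞]`, for a function `N` in the role of `‖·‖`. -/
def gagliardo {n : ℕ} (p s : ℝ) (N : Rn n → ℝ) (f : Rn n → ℝ) : ℝ≥0∞ :=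
  ∫⁻ y, ∫⁻ x, ENNReal.ofReal (|f x - f y| ^ p / N (x - y) ^ ((n : ℝ) + s * p))

/-- The norm `‖·‖` with unit ball `polarMomentBody p K` is given by the defining formula. -/
theorem gauge_polarMomentBody_rpow {n : ℕ} {p : ℝ} (hp : 1 ≤ p) (K : Set (Rn n)) (v : Rn n) :
    gauge (polarMomentBody p K) v ^ p = polarMomentPow p K v := by
  have hp0 : 0 < p := by linarith
  have hnn : ∀ w : Rn n, 0 ≤ polarMomentPow p K w := fun w => by
    unfold polarMomentPow
    have : 0 ≤ ∫ x in K, |⟪w, x⟫| ^ p := integral_nonneg fun x => by positivity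
    positivity
  set N := polarMomentPow p K v ^ (1 / p) with hN
  have hN0 : 0 ≤ N := Real.rpow_nonneg (hnn v) _
  have hhom : ∀ r : ℝ, 0 < r → polarMomentPow p K (r⁻¹ • v) ^ (1 / p) = r⁻¹ * N := by
    intro r hr
    have h1 : polarMomentPow p K (r⁻¹ • v) = r⁻¹ ^ p * polarMomentPow p K v := by
      unfold polarMomentPow
      have h2 : ∀ x : Rn n, |⟪r⁻¹ • v, x⟫| ^ p = r⁻¹ ^ p * |⟪v, x⟫| ^ p := fun x => by
        rw [real_inner_smul_left, abs_mul, abs_of_pos (inv_pos.2 hr),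
          Real.mul_rpow (inv_pos.2 hr).le (abs_nonneg _)]
      simp_rw [h2]
      rw [integral_const_mul]
      ring
    rw [h1, Real.mul_rpow (by positivity) (hnn v), ← Real.rpow_mul (inv_pos.2 hr).le,
      mul_one_div_cancel hp0.ne', Real.rpow_one]
  have hset : {r ∈ Set.Ioi (0 : ℝ) | r⁻¹ • v ∈ polarMomentBody p K} =
      {r : ℝ | 0 < r ∧ N ≤ r} := by
    ext r
    constructor
    · rintro ⟨hr, h⟩
      have hr : 0 < r := hr
      have h : polarMomentPow p K (r⁻¹ • v) ^ (1 / p) ≤ 1 := h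
      rw [hhom r hr, inv_mul_le_iff₀ hr, mul_one] at h
      exact ⟨hr, h⟩
    · rintro ⟨hr, h⟩
      refine ⟨hr, ?_⟩
      change polarMomentPow p K (r⁻¹ • v) ^ (1 / p) ≤ 1
      rw [hhom r hr, inv_mul_le_iff₀ hr, mul_one]
      exact h
  have hg : gauge (polarMomentBody p K) v = N := by
    rw [gauge_def', hset]
    apply le_antisymm
    · apply le_of_forall_pos_le_add
      intro ε hε
      exact csInf_le ⟨0, fun r hr => hr.1.le⟩ ⟨by linarith, by linarith⟩
    · exact le_csInf ⟨N + 1, by linarith, by linarith⟩ fun r hr => hr.2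
  rw [hg, hN, ← Real.rpow_mul (hnn v), one_div_mul_cancel hp0.ne', Real.rpow_one]

end

/-! Put `h = x - y`. The layer-cake formula `N(h)^(-q) = ∫_{N(h)}^∞ q r^(-q-1) dr` with `q = n +
sp`, followed by the dilation `h ↦ r h`, turns the Gagliardo integral into `∫_0^∞ q r^(p(1-s)-1)
a(r) dr`, where `a(r)` is the integral over `h ∈ K` and `x` of the `p`-th power of the difference
quotient `(f(x+rh) - f(x))/r` (`gagliardo_eq_lintegral_difference_quotient`). Only the
one-dimensional weight depends on `s`, and only `a` depends on `f` and `K`.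

As `s → 1` the weights `(1-s) q r^(p(1-s)-1)` concentrate at `0` with mass `(n+p)/p`, so the limit
is `(n+p)/p` times `lim_{r→0} a(r)` (`tendsto_lintegral_power_weight`). The limit of `a` is `∫_K ∫
|∇f(x)·h|^p dx dh`, by dominated convergence in `h` and the convergence of difference quotients in
`L^p` (`HasWeakGradient.tendsto_lintegral_difference_quotient`). The latter rests on the identity
`f(x+h) - f(x) = ∫_0^1 ∇f(x+th)·h dt` for almost every `x`, together with Jensen's inequality and
continuity of translations in `L^p`.

Exchanging the integrals over `x` and `h` produces the polar moment norm. For the Euclidean ball,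
that norm is a multiple of `|v|` by reflection invariance, and polar coordinates give the constant.
-/

/-! ### Powers of extended norms and Jensen's inequality -/

theorem ofReal_abs_rpow_eq_enorm_rpow {p : ℝ} (hp : 0 ≤ p) (a : ℝ) :
    ENNReal.ofReal (|a| ^ p) = ‖a‖ₑ ^ p := by
  rw [← ENNReal.ofReal_rpow_of_nonneg (abs_nonneg a) hp, Real.enorm_eq_ofReal_abs]

theorem lintegral_enorm_rpow_eq_eLpNorm_rpow {α E : Type*} [MeasurableSpace α]
    [NormedAddCommGroup E] {p : ℝ} (hp : 0 < p) (μ : Measure α) (F : α → E) :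
    ∫⁻ x, ‖F x‖ₑ ^ p ∂μ = eLpNorm F (ENNReal.ofReal p) μ ^ p := by
  rw [eLpNorm_eq_lintegral_rpow_enorm_toReal (by simpa using hp) (by simp),
    ENNReal.toReal_ofReal hp.le, ← ENNReal.rpow_mul, one_div_mul_cancel hp.ne', ENNReal.rpow_one]

/-- Jensen's inequality for `|·|^p` and the mean over a probability space. -/
theorem enorm_integral_rpow_le {α : Type*} [MeasurableSpace α] {μ : Measure α}
    [IsProbabilityMeasure μ] {p : ℝ} (hp : 1 ≤ p) {F : α → ℝ} (hF : AEStronglyMeasurable F μ) :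
    ‖∫ x, F x ∂μ‖ₑ ^ p ≤ ∫⁻ x, ‖F x‖ₑ ^ p ∂μ := by
  rw [lintegral_enorm_rpow_eq_eLpNorm_rpow (by linarith)]
  gcongr
  calc ‖∫ x, F x ∂μ‖ₑ ≤ ∫⁻ x, ‖F x‖ₑ ∂μ := enorm_integral_le_lintegral_enorm _
    _ = eLpNorm F 1 μ := eLpNorm_one_eq_lintegral_enorm.symm
    _ ≤ _ := eLpNorm_le_eLpNorm_of_exponent_le (by simpa using hp) hF

/-- Minkowski's integral inequality over a probability space, in the form given by Jensen. -/
theorem lintegral_enorm_integral_rpow_le {α β : Type*} [MeasurableSpace α] [MeasurableSpace β]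
    {μ : Measure α} [SFinite μ] {ν : Measure β} [IsProbabilityMeasure ν] {p : ℝ} (hp : 1 ≤ p)
    {u : α → β → ℝ} (hu : Measurable (Function.uncurry u)) :
    ∫⁻ x, ‖∫ t, u x t ∂ν‖ₑ ^ p ∂μ ≤ ∫⁻ t, ∫⁻ x, ‖u x t‖ₑ ^ p ∂μ ∂ν := by
  rw [lintegral_lintegral_swap
    (f := fun t x => ‖u x t‖ₑ ^ p)
    ((hu.comp measurable_swap).enorm.pow_const p).aemeasurable]
  exact lintegral_mono fun x => enorm_integral_rpow_le hp
    (hu.comp measurable_prodMk_left).aestronglyMeasurable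

instance isProbabilityMeasure_restrict_Ioc_zero_one :
    IsProbabilityMeasure ((volume : Measure ℝ).restrict (Set.Ioc 0 1)) :=
  ⟨by simp⟩

/-! ### Integrability along segments, for Fubini -/

section Segment

variable {E : Type*} [NormedAddCommGroup E] [NormedSpace ℝ E]

theorem isCompact_segment_translates {C : Set E} (hC : IsCompact C) (h : E) :
    IsCompact ((fun z : E × ℝ => z.1 + z.2 • h) '' (C ×ˢ Set.Icc 0 1)) :=
  (hC.prod isCompact_Icc).image (by fun_prop)

variable [MeasurableSpace E] [BorelSpace E] [SecondCountableTopology E] {μ : Measure E}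

/-- Integrability of a locally integrable function along translates of a compact set. -/
theorem integrable_prod_translate [SFinite μ] [μ.IsAddRightInvariant] {γ : E → ℝ}
    (hγm : Measurable γ) (hγ : LocallyIntegrable γ μ)
    {C : Set E} (hC : IsCompact C) (h : E) :
    Integrable (fun z : E × ℝ => γ (z.1 + z.2 • h))
      ((μ.restrict C).prod (volume.restrict (Set.Ioc 0 1))) := by
  have hm : Measurable (fun z : E × ℝ => γ (z.1 + z.2 • h)) := hγm.comp (by fun_prop)
  refine ⟨hm.aestronglyMeasurable, ?_⟩
  -- `C'` is the compact set swept out by translating `C` along the segment; it bounds every slice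
  -- in `t` by one finite integral.
  set C' := (fun z : E × ℝ => z.1 + z.2 • h) '' (C ×ˢ Set.Icc 0 1) with hC'
  have hfin : ∫⁻ x in C', ‖γ x‖ₑ ∂μ < ⊤ :=
    (hγ.integrableOn_isCompact (isCompact_segment_translates hC h)).2
  rw [HasFiniteIntegral, lintegral_prod_symm _ hm.enorm.aemeasurable]
  calc ∫⁻ t in Set.Ioc (0 : ℝ) 1, ∫⁻ x in C, ‖γ (x + t • h)‖ₑ ∂μ
      ≤ ∫⁻ t in Set.Ioc (0 : ℝ) 1, ∫⁻ x in C', ‖γ x‖ₑ ∂μ := by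
        refine setLIntegral_mono' measurableSet_Ioc fun t ht => ?_
        rw [← lintegral_indicator hC.measurableSet,
          ← lintegral_indicator (isCompact_segment_translates hC h).measurableSet,
          ← lintegral_add_right_eq_self (μ := μ) (C'.indicator fun x => ‖γ x‖ₑ) (t • h)]
        refine lintegral_mono fun x => ?_
        by_cases hx : x ∈ C
        · have : x + t • h ∈ C' := ⟨(x, t), ⟨hx, ht.1.le, ht.2⟩, rfl⟩
          simp [hx, this]
        · simp [hx]
    _ = ∫⁻ x in C', ‖γ x‖ₑ ∂μ := by simp
    _ < ⊤ := hfin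

theorem integrable_prod_mul_translate [SFinite μ] [μ.IsAddRightInvariant] {γ ψ : E → ℝ}
    (hγm : Measurable γ) (hγ : LocallyIntegrable γ μ)
    (hψ : Continuous ψ) (hψc : HasCompactSupport ψ) (h : E) :
    Integrable (fun z : E × ℝ => ψ z.1 * γ (z.1 + z.2 • h))
      (μ.prod (volume.restrict (Set.Ioc 0 1))) := by
  have h1 := integrable_prod_translate hγm hγ hψc h
  obtain ⟨M, hM⟩ := hψ.bounded_above_of_compact_support hψc
  have h2 : Integrable (fun z : E × ℝ => ψ z.1 * γ (z.1 + z.2 • h))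
      ((μ.restrict (tsupport ψ)).prod (volume.restrict (Set.Ioc 0 1))) :=
    h1.bdd_mul (hψ.comp continuous_fst).aestronglyMeasurable (c := M)
      (Eventually.of_forall fun z => hM z.1)
  have h3 : (μ.restrict (tsupport ψ)).prod (volume.restrict (Set.Ioc (0 : ℝ) 1)) =
      (μ.prod (volume.restrict (Set.Ioc 0 1))).restrict (tsupport ψ ×ˢ Set.univ) := by
    rw [← Measure.prod_restrict, Measure.restrict_univ]
  rw [h3] at h2
  refine (integrableOn_iff_integrable_of_support_subset ?_).1 h2
  rintro ⟨x, t⟩ hz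
  refine ⟨subset_tsupport _ fun hx => hz (by simp [hx]), trivial⟩

/-- Here the translation falls on the continuous factor, so `γ` may be cut off to a compact set that
does not depend on `t`, and `ψ` is bounded. -/
theorem integrable_prod_mul_sub_translate {γ ψ : E → ℝ}
    (hγ : LocallyIntegrable γ μ) (hψ : Continuous ψ) (hψc : HasCompactSupport ψ) (h : E) :
    Integrable (fun z : E × ℝ => γ z.1 * ψ (z.1 - z.2 • h))
      (μ.prod (volume.restrict (Set.Ioc 0 1))) := by
  obtain ⟨M, hM⟩ := hψ.bounded_above_of_compact_support hψc
  set C' := (fun z : E × ℝ => z.1 + z.2 • h) '' (tsupport ψ ×ˢ Set.Icc 0 1) with hC'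
  have hcomp : IsCompact C' := isCompact_segment_translates hψc h
  have h1 : Integrable (fun z : E × ℝ => C'.indicator γ z.1)
      (μ.prod (volume.restrict (Set.Ioc 0 1))) :=
    ((integrable_indicator_iff hcomp.measurableSet).2 (hγ.integrableOn_isCompact hcomp)).comp_fst _
  have h2 : Integrable (fun z : E × ℝ => ψ (z.1 - z.2 • h) * C'.indicator γ z.1)
      (μ.prod (volume.restrict (Set.Ioc 0 1))) :=
    h1.bdd_mul (by fun_prop) (c := M) (Eventually.of_forall fun z => hM _)
  refine h2.congr ?_
  have h3 : ∀ᵐ z : E × ℝ ∂(μ.prod (volume.restrict (Set.Ioc 0 1))), z.2 ∈ Set.Ioc (0 : ℝ) 1 :=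
    Measure.quasiMeasurePreserving_snd.ae (ae_restrict_mem measurableSet_Ioc)
  filter_upwards [h3] with z hz
  by_cases hx : z.1 - z.2 • h ∈ tsupport ψ
  · have : z.1 ∈ C' := ⟨(z.1 - z.2 • h, z.2), ⟨hx, hz.1.le, hz.2⟩, by simp⟩
    simp [this, mul_comm]
  · simp [image_eq_zero_of_notMem_tsupport hx]

end Segment

/-! ### Weak gradients and the fundamental theorem of calculus on segments -/

section WeakGradient

theorem MeasureTheory.LocallyIntegrable.comp_add_right {E F : Type*} [NormedAddCommGroup E]
    [NormedSpace ℝ E] [FiniteDimensional ℝ E] [MeasurableSpace E] [BorelSpace E]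
    [NormedAddCommGroup F] {μ : Measure E} [μ.IsAddRightInvariant] {f : E → F}
    (hf : LocallyIntegrable f μ) (h : E) : LocallyIntegrable (fun x => f (x + h)) μ := by
  rw [locallyIntegrable_iff]
  intro C hC
  have h1 := hf.integrableOn_isCompact (hC.image (continuous_add_const h))
  have h2 := ((measurePreserving_add_right μ h).integrableOn_comp_preimage
    (measurableEmbedding_addRight h)).2 h1
  rwa [Set.preimage_image_eq _ (add_left_injective h)] at h2

variable {n : ℕ}

theorem HasWeakGradient.locallyIntegrable_inner {f : Rn n → ℝ} {g : Rn n → Rn n}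
    (hg : HasWeakGradient f g) (h : Rn n) : LocallyIntegrable (fun x => ⟪g x, h⟫) := by
  rw [locallyIntegrable_iff]
  intro C hC
  exact (hg.2.1.integrableOn_isCompact hC).inner_const h

/-- The backward difference is what remains on the test function once the translation of `f` has
been moved onto it. -/
theorem sub_translate_eq_integral_fderiv {φ : Rn n → ℝ} (hφ : ContDiff ℝ ∞ φ) (x h : Rn n) :
    φ x - φ (x - h) = ∫ t in Set.Ioc (0 : ℝ) 1, fderiv ℝ φ (x - t • h) h := by
  have hd : ∀ t ∈ Set.uIcc (0 : ℝ) 1,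
      HasDerivAt (fun t : ℝ => - φ (x - t • h)) (fderiv ℝ φ (x - t • h) h) t := by
    intro t _
    have h1 : HasDerivAt (fun t : ℝ => x - t • h) (-h) t := by
      simpa using ((hasDerivAt_id t).smul_const h).const_sub x
    have h2 := ((hφ.differentiable (by simp) (x - t • h)).hasFDerivAt.comp_hasDerivAt t h1).neg
    simp only [map_neg, neg_neg] at h2
    exact h2
  have hc : Continuous fun t : ℝ => fderiv ℝ φ (x - t • h) h :=
    ((hφ.continuous_fderiv (by simp)).comp (by fun_prop)).clm_apply continuous_const
  have := intervalIntegral.integral_eq_sub_of_hasDerivAt hd (hc.intervalIntegrable 0 1)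
  rw [intervalIntegral.integral_of_le zero_le_one] at this
  rw [this]
  simp
  ring

/-- A function with a weak gradient satisfies the fundamental theorem of calculus along almost
every segment of a given direction. -/
theorem HasWeakGradient.sub_eq_integral_inner {f : Rn n → ℝ} {g : Rn n → Rn n}
    (hg : HasWeakGradient f g) (hgm : Measurable g) (h : Rn n) :
    ∀ᵐ x, f (x + h) - f x = ∫ t in Set.Ioc (0 : ℝ) 1, ⟪g (x + t • h), h⟫ := by
  have hγ := hg.locallyIntegrable_inner h
  have hγm : Measurable fun x => ⟪g x, h⟫ := hgm.inner_const
  -- Both sides are locally integrable, so it suffices to compare them against test functions; the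
  -- translation is moved onto `φ`, the weak gradient is applied for each `t`, and the translation
  -- is moved back.
  refine ae_eq_of_integral_contDiff_smul_eq ((hg.1.comp_add_right h).sub hg.1) ?_ ?_
  · rw [locallyIntegrable_iff]
    exact fun C hC => (integrable_prod_translate hγm hγ hC h).integral_prod_left
  intro φ hφ hφc
  have hDφ : Continuous fun x => fderiv ℝ φ x h :=
    (hφ.continuous_fderiv (by simp)).clm_apply continuous_const
  have hDφc : HasCompactSupport fun x => fderiv ℝ φ x h := hφc.fderiv_apply ℝ h
  have hint : ∀ ψ : Rn n → ℝ, Continuous ψ → HasCompactSupport ψ →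
      ∀ k : Rn n → ℝ, LocallyIntegrable k → Integrable fun x => ψ x * k x :=
    fun ψ h1 h2 k h3 => h3.integrable_smul_left_of_hasCompactSupport h1 h2
  have hφs : HasCompactSupport fun x => φ (x - h) := hφc.comp_homeomorph (Homeomorph.subRight h)
  have hshift : ∫ x, φ x * f (x + h) = ∫ x, φ (x - h) * f x := by
    rw [← integral_add_right_eq_self (fun x => φ (x - h) * f x) h]
    simp
  simp only [smul_eq_mul]
  calc ∫ x, φ x * (f (x + h) - f x)
      = - ∫ x, f x * (φ x - φ (x - h)) := by
        simp only [mul_sub]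
        rw [integral_sub (hint _ hφ.continuous hφc _ (hg.1.comp_add_right h))
          (hint _ hφ.continuous hφc _ hg.1), hshift, integral_sub]
        · simp only [mul_comm (f _)]
          ring
        · simpa only [mul_comm (f _)] using hint _ hφ.continuous hφc _ hg.1
        · simpa only [mul_comm (f _)] using hint _ (by fun_prop) hφs _ hg.1
    _ = - ∫ x, ∫ t in Set.Ioc (0 : ℝ) 1, f x * fderiv ℝ φ (x - t • h) h := by
        simp_rw [integral_const_mul, ← sub_translate_eq_integral_fderiv hφ]
    _ = - ∫ t in Set.Ioc (0 : ℝ) 1, ∫ x, f x * fderiv ℝ φ (x - t • h) h := by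
        rw [integral_integral_swap]
        exact integrable_prod_mul_sub_translate hg.1 hDφ hDφc h
    _ = ∫ t in Set.Ioc (0 : ℝ) 1, ∫ x, φ (x - t • h) * ⟪g x, h⟫ := by
        rw [← integral_neg]
        congr 1 with t
        -- The translated function is again a test function, so the definition of weak gradient
        -- applies for each fixed `t`.
        have h1 := hg.2.2 (fun x => φ (x - t • h)) (by fun_prop)
          (hφc.comp_homeomorph (Homeomorph.subRight (t • h))) h
        simp only [fderiv_comp_sub] at h1
        rw [h1, neg_neg]
    _ = ∫ t in Set.Ioc (0 : ℝ) 1, ∫ x, φ x * ⟪g (x + t • h), h⟫ := by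
        congr 1 with t
        rw [← integral_add_right_eq_self (fun x => φ (x - t • h) * ⟪g x, h⟫) (t • h)]
        simp
    _ = ∫ x, ∫ t in Set.Ioc (0 : ℝ) 1, φ x * ⟪g (x + t • h), h⟫ := by
        rw [integral_integral_swap]
        exact (integrable_prod_mul_translate hγm hγ hφ.continuous hφc h).swap
    _ = ∫ x, φ x * ∫ t in Set.Ioc (0 : ℝ) 1, ⟪g (x + t • h), h⟫ := by
        simp_rw [integral_const_mul]

/-- Weak gradients are unique up to null sets. -/
theorem HasWeakGradient.ae_eq {f : Rn n → ℝ} {g g' : Rn n → Rn n}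
    (hg : HasWeakGradient f g) (hg' : HasWeakGradient f g') : g =ᵐ[volume] g' := by
  refine ae_eq_of_integral_contDiff_smul_eq hg.2.1 hg'.2.1 fun φ hφ hφc => ?_
  have h1 := hg.2.1.integrable_smul_left_of_hasCompactSupport hφ.continuous hφc
  have h2 := hg'.2.1.integrable_smul_left_of_hasCompactSupport hφ.continuous hφc
  refine ext_inner_right ℝ fun v => ?_
  rw [real_inner_comm, ← integral_inner h1, real_inner_comm, ← integral_inner h2]
  simp only [inner_smul_right]
  have h3 := hg.2.2 φ hφ hφc v
  rw [hg'.2.2 φ hφ hφc v, neg_inj] at h3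
  simpa only [real_inner_comm] using h3.symm

theorem HasWeakGradient.congr {f f' : Rn n → ℝ} {g g' : Rn n → Rn n}
    (hg : HasWeakGradient f g) (hf : f =ᵐ[volume] f') (hgg : g =ᵐ[volume] g') :
    HasWeakGradient f' g' := by
  refine ⟨hg.1.congr hf, hg.2.1.congr hgg, fun φ hφ hφc v => ?_⟩
  have h1 : ∫ x, f' x * fderiv ℝ φ x v = ∫ x, f x * fderiv ℝ φ x v :=
    integral_congr_ae (by filter_upwards [hf] with x hx; rw [hx])
  have h2 : ∫ x, φ x * ⟪g' x, v⟫ = ∫ x, φ x * ⟪g x, v⟫ :=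
    integral_congr_ae (by filter_upwards [hgg] with x hx; rw [hx])
  rw [h1, h2, hg.2.2 φ hφ hφc v]

end WeakGradient

/-! ### Convergence of difference quotients in `L^p` -/

section DifferenceQuotient

/-- Translations are continuous in `L^p`. -/
theorem tendsto_eLpNorm_translate_sub {E F : Type*} [NormedAddCommGroup E] [NormedSpace ℝ E]
    [FiniteDimensional ℝ E] [MeasurableSpace E] [BorelSpace E] [NormedAddCommGroup F]
    {μ : Measure E} [μ.IsAddHaarMeasure] {q : ℝ≥0∞} (hq1 : 1 ≤ q) (hq : q ≠ ⊤) {γ : E → F}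
    (hγ : MemLp γ q μ) :
    Tendsto (fun k => eLpNorm (fun x => γ (x + k) - γ x) q μ) (𝓝 0) (𝓝 0) := by
  have : Fact (1 ≤ q) := ⟨hq1⟩
  have : Fact (q ≠ ⊤) := ⟨hq⟩
  -- This reduces the claim to continuity of the translation action on `L^p`.
  have h1 : ∀ k : E, eLpNorm (fun x => γ (x + k) - γ x) q μ =
      edist (DomAddAct.mk k +ᵥ hγ.toLp γ) (hγ.toLp γ) := by
    intro k
    rw [DomAddAct.mk_vadd_toLp, Lp.edist_toLp_toLp]
    congr 1
    ext x
    simp [add_comm]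
  have h2 : Continuous fun k : E => edist (DomAddAct.mk k +ᵥ hγ.toLp γ) (hγ.toLp γ) := by
    have : Continuous (DomAddAct.mk : E → Eᵈᵃᵃ) := DomAddAct.continuous_mk
    fun_prop
  simp_rw [h1]
  have h3 := h2.tendsto 0
  simpa using h3

variable {n : ℕ} {p : ℝ}

/-- Jensen moves the power inside the mean over the segment, and by translation invariance every `t`
contributes the same amount. -/
theorem HasWeakGradient.lintegral_sub_translate_le {f : Rn n → ℝ} {g : Rn n → Rn n}
    (hg : HasWeakGradient f g) (hgm : Measurable g) (hp : 1 ≤ p) (h : Rn n) :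
    ∫⁻ x, ‖f (x + h) - f x‖ₑ ^ p ≤ ∫⁻ x, ‖⟪g x, h⟫‖ₑ ^ p := by
  calc ∫⁻ x, ‖f (x + h) - f x‖ₑ ^ p
      = ∫⁻ x, ‖∫ t in Set.Ioc (0 : ℝ) 1, ⟪g (x + t • h), h⟫‖ₑ ^ p := by
        refine lintegral_congr_ae ?_
        filter_upwards [hg.sub_eq_integral_inner hgm h] with x hx
        rw [hx]
    _ ≤ ∫⁻ t in Set.Ioc (0 : ℝ) 1, ∫⁻ x, ‖⟪g (x + t • h), h⟫‖ₑ ^ p :=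
        lintegral_enorm_integral_rpow_le hp (u := fun x t => ⟪g (x + t • h), h⟫)
          ((hgm.comp (by fun_prop : Measurable fun z : Rn n × ℝ => z.1 + z.2 • h)).inner_const)
    _ = ∫⁻ t in Set.Ioc (0 : ℝ) 1, ∫⁻ x, ‖⟪g x, h⟫‖ₑ ^ p := by
        congr 1 with t
        exact lintegral_add_right_eq_self (fun x => ‖⟪g x, h⟫‖ₑ ^ p) (t • h)
    _ = _ := by simp

/-- By Tonelli almost every segment carries a finite `p`-th power integral, and on a probability
space `L^p` embeds in `L^1`. This permits splitting the integral of the difference in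
`difference_quotient_sub_inner`. -/
theorem ae_integrable_translate {γ : Rn n → ℝ} (hp : 1 ≤ p) (hγm : Measurable γ)
    (hγ : ∫⁻ x, ‖γ x‖ₑ ^ p ≠ ⊤) (h : Rn n) :
    ∀ᵐ x, Integrable (fun t : ℝ => γ (x + t • h)) (volume.restrict (Set.Ioc (0 : ℝ) 1)) := by
  have hp0 : 0 < p := by linarith
  have hum : Measurable fun z : Rn n × ℝ => γ (z.1 + z.2 • h) := hγm.comp (by fun_prop)
  have hshift : ∀ k : Rn n, ∫⁻ x, ‖γ (x + k)‖ₑ ^ p = ∫⁻ x, ‖γ x‖ₑ ^ p := fun k =>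
    lintegral_add_right_eq_self (fun x => ‖γ x‖ₑ ^ p) k
  have hfin : ∀ᵐ x, ∫⁻ t in Set.Ioc (0 : ℝ) 1, ‖γ (x + t • h)‖ₑ ^ p < ⊤ := by
    refine ae_lt_top (hum.enorm.pow_const p).lintegral_prod_right' ?_
    rw [lintegral_lintegral_swap (hum.enorm.pow_const p).aemeasurable]
    simp [hshift, hγ]
  filter_upwards [hfin] with x hx
  have hm : Measurable (fun t : ℝ => γ (x + t • h)) := hum.comp measurable_prodMk_left
  refine MemLp.integrable (q := ENNReal.ofReal p) (by simpa using hp)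
    ⟨hm.aestronglyMeasurable, ?_⟩
  rw [lintegral_enorm_rpow_eq_eLpNorm_rpow hp0] at hx
  exact (ENNReal.rpow_lt_top_iff_of_pos hp0).1 hx

theorem tendsto_eLpNorm_integral_translate_sub {γ : Rn n → ℝ} (hp : 1 ≤ p) (hγm : Measurable γ)
    (hγ : MemLp γ (ENNReal.ofReal p)) (h : Rn n) :
    Tendsto (fun r : ℝ => eLpNorm
      (fun x => ∫ t in Set.Ioc (0 : ℝ) 1, (γ (x + t • r • h) - γ x)) (ENNReal.ofReal p) volume)
      (𝓝[>] 0) (𝓝 0) := by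
  have hp0 : 0 < p := by linarith
  rw [ENNReal.tendsto_nhds_zero]
  intro ε hε
  have h1 := (ENNReal.tendsto_nhds_zero.1
    (tendsto_eLpNorm_translate_sub (by simpa using hp) ENNReal.ofReal_ne_top hγ)) ε hε
  obtain ⟨δ, hδ, hball⟩ := Metric.eventually_nhds_iff.1 h1
  have h2 : Tendsto (fun r : ℝ => r * ‖h‖) (𝓝[>] 0) (𝓝 0) := by
    have : Tendsto (fun r : ℝ => r * ‖h‖) (𝓝 0) (𝓝 (0 * ‖h‖)) :=
      (continuous_id.mul continuous_const).tendsto 0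
    rw [zero_mul] at this
    exact this.mono_left nhdsWithin_le_nhds
  filter_upwards [self_mem_nhdsWithin, h2.eventually_lt_const hδ] with r hr hrδ
  have hr : 0 < r := hr
  rw [← ENNReal.rpow_le_rpow_iff hp0, ← lintegral_enorm_rpow_eq_eLpNorm_rpow hp0]
  have hum : Measurable fun z : Rn n × ℝ => γ (z.1 + z.2 • r • h) - γ z.1 :=
    (hγm.comp (by fun_prop)).sub (hγm.comp measurable_fst)
  calc _ ≤ ∫⁻ t in Set.Ioc (0 : ℝ) 1, ∫⁻ x, ‖γ (x + t • r • h) - γ x‖ₑ ^ p :=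
        lintegral_enorm_integral_rpow_le hp (u := fun x t => γ (x + t • r • h) - γ x) hum
    _ ≤ ∫⁻ t in Set.Ioc (0 : ℝ) 1, ε ^ p := by
        refine setLIntegral_mono' measurableSet_Ioc fun t ht => ?_
        rw [lintegral_enorm_rpow_eq_eLpNorm_rpow hp0]
        gcongr
        refine hball ?_
        rw [dist_zero_right, norm_smul, norm_smul, Real.norm_eq_abs, Real.norm_eq_abs,
          abs_of_pos ht.1, abs_of_pos hr]
        calc t * (r * ‖h‖) ≤ 1 * (r * ‖h‖) := by gcongr; exact ht.2
          _ < δ := by rwa [one_mul]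
    _ = ε ^ p := by simp

theorem HasWeakGradient.lintegral_difference_quotient_le {f : Rn n → ℝ} {g : Rn n → Rn n}
    (hg : HasWeakGradient f g) (hfm : Measurable f) (hgm : Measurable g)
    (hp : 1 ≤ p) (h : Rn n) {r : ℝ} (hr : 0 < r) :
    ∫⁻ x, ‖r⁻¹ * (f (x + r • h) - f x)‖ₑ ^ p ≤ ∫⁻ x, ‖⟪g x, h⟫‖ₑ ^ p := by
  have hp0 : 0 < p := by linarith
  have h1 := hg.lintegral_sub_translate_le hgm hp (r • h)
  have hm : Measurable fun x => ‖f (x + r • h) - f x‖ₑ ^ p :=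
    ((hfm.comp (measurable_add_const (r • h))).sub hfm).enorm.pow_const p
  simp only [inner_smul_right, enorm_mul, ENNReal.mul_rpow_of_nonneg _ _ hp0.le] at h1 ⊢
  rw [lintegral_const_mul _ ((hgm.inner_const (c := h)).enorm.pow_const p)] at h1
  rw [lintegral_const_mul _ hm]
  calc _ ≤ ‖r⁻¹‖ₑ ^ p * (‖r‖ₑ ^ p * ∫⁻ x, ‖⟪g x, h⟫‖ₑ ^ p) := by gcongr
    _ = _ := by
      rw [← mul_assoc, ← ENNReal.mul_rpow_of_nonneg _ _ hp0.le, ← enorm_mul,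
        inv_mul_cancel₀ hr.ne']
      simp

theorem HasWeakGradient.difference_quotient_sub_inner {f : Rn n → ℝ} {g : Rn n → Rn n}
    (hg : HasWeakGradient f g) (hgm : Measurable g)
    (hgp : MemLp g (ENNReal.ofReal p)) (hp : 1 ≤ p) (h : Rn n) {r : ℝ} (hr : 0 < r) :
    ∀ᵐ x, r⁻¹ * (f (x + r • h) - f x) - ⟪g x, h⟫ =
      ∫ t in Set.Ioc (0 : ℝ) 1, (⟪g (x + t • r • h), h⟫ - ⟪g x, h⟫) := by
  have hp0 : 0 < p := by linarith
  have hγ : ∫⁻ x, ‖⟪g x, h⟫‖ₑ ^ p ≠ ⊤ := by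
    rw [lintegral_enorm_rpow_eq_eLpNorm_rpow hp0]
    exact (ENNReal.rpow_lt_top_of_nonneg hp0.le (hgp.inner_const h).2.ne).ne
  filter_upwards [ae_integrable_translate hp hgm.inner_const hγ (r • h),
    hg.sub_eq_integral_inner hgm (r • h)] with x hx1 hx2
  rw [integral_sub hx1 (integrable_const _), hx2]
  simp only [inner_smul_right]
  rw [integral_const_mul, ← mul_assoc, inv_mul_cancel₀ hr.ne']
  simp

/-- Difference quotients of a Sobolev function converge in `L^p`-norm. -/
theorem HasWeakGradient.tendsto_lintegral_difference_quotient {f : Rn n → ℝ} {g : Rn n → Rn n}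
    (hg : HasWeakGradient f g) (hfm : Measurable f) (hgm : Measurable g)
    (hgp : MemLp g (ENNReal.ofReal p)) (hp : 1 ≤ p) (h : Rn n) :
    Tendsto (fun r : ℝ => ∫⁻ x, ‖r⁻¹ * (f (x + r • h) - f x)‖ₑ ^ p) (𝓝[>] 0)
      (𝓝 (∫⁻ x, ‖⟪g x, h⟫‖ₑ ^ p)) := by
  have hp0 : 0 < p := by linarith
  have hγm : Measurable fun x => ⟪g x, h⟫ := hgm.inner_const
  have hγ := hgp.inner_const (𝕜 := ℝ) h
  have hD : Tendsto (fun r : ℝ => eLpNorm (fun x => r⁻¹ * (f (x + r • h) - f x) - ⟪g x, h⟫)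
      (ENNReal.ofReal p) volume) (𝓝[>] 0) (𝓝 0) := by
    refine (tendsto_eLpNorm_integral_translate_sub hp hγm hγ h).congr' ?_
    filter_upwards [self_mem_nhdsWithin] with r hr
    exact eLpNorm_congr_ae (EventuallyEq.symm (hg.difference_quotient_sub_inner hgm hgp hp h hr))
  -- The lower bound is the reverse triangle inequality; the upper bound holds for every `r > 0` by
  -- Jensen, so the norms are squeezed.
  have hlow : Tendsto (fun r : ℝ => eLpNorm (fun x => ⟪g x, h⟫) (ENNReal.ofReal p) volume -
      eLpNorm (fun x => r⁻¹ * (f (x + r • h) - f x) - ⟪g x, h⟫) (ENNReal.ofReal p) volume)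
      (𝓝[>] 0) (𝓝 (eLpNorm (fun x => ⟪g x, h⟫) (ENNReal.ofReal p) volume)) := by
    simpa using ENNReal.Tendsto.sub (tendsto_const_nhds
      (x := eLpNorm (fun x => ⟪g x, h⟫) (ENNReal.ofReal p) volume)) hD (Or.inl hγ.2.ne)
  have hmain : Tendsto
      (fun r : ℝ => eLpNorm (fun x => r⁻¹ * (f (x + r • h) - f x)) (ENNReal.ofReal p) volume)
      (𝓝[>] 0) (𝓝 (eLpNorm (fun x => ⟪g x, h⟫) (ENNReal.ofReal p) volume)) := by
    refine tendsto_of_tendsto_of_tendsto_of_le_of_le' hlow tendsto_const_nhds ?_ ?_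
    · refine Eventually.of_forall fun r => ?_
      have hDm : Measurable fun x => r⁻¹ * (f (x + r • h) - f x) :=
        ((hfm.comp (measurable_add_const (r • h))).sub hfm).const_mul _
      rw [tsub_le_iff_right]
      have := eLpNorm_sub_le (p := ENNReal.ofReal p) (μ := volume) hDm.aestronglyMeasurable
        (hDm.sub hγm).aestronglyMeasurable (by simpa using hp)
      simp only [sub_sub_cancel] at this
      exact this
    · filter_upwards [self_mem_nhdsWithin] with r hr
      rw [← ENNReal.rpow_le_rpow_iff hp0, ← lintegral_enorm_rpow_eq_eLpNorm_rpow hp0,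
        ← lintegral_enorm_rpow_eq_eLpNorm_rpow hp0]
      exact hg.lintegral_difference_quotient_le hfm hgm hp h hr
  simp_rw [lintegral_enorm_rpow_eq_eLpNorm_rpow hp0]
  exact (ENNReal.continuous_rpow_const.tendsto _).comp hmain

end DifferenceQuotient

/-! ### One-dimensional power weights concentrating at the origin -/

theorem setLIntegral_Ioc_rpow {c e δ : ℝ} (hc : 0 ≤ c) (he : 0 < e) (hδ : 0 ≤ δ) :
    ∫⁻ r in Set.Ioc 0 δ, ENNReal.ofReal (c * r ^ (e - 1)) = ENNReal.ofReal (c * δ ^ e / e) := by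
  have hint : IntegrableOn (fun r : ℝ => r ^ (e - 1)) (Set.Ioc 0 δ) :=
    (intervalIntegrable_iff_integrableOn_Ioc_of_le hδ).1
      (intervalIntegral.intervalIntegrable_rpow' (by linarith))
  rw [← ofReal_integral_eq_lintegral_ofReal (hint.const_mul c), integral_const_mul,
    ← intervalIntegral.integral_of_le hδ, integral_rpow (Or.inl (by linarith)), sub_add_cancel,
    Real.zero_rpow he.ne', sub_zero, mul_div_assoc]
  filter_upwards [ae_restrict_mem measurableSet_Ioc] with r hr
  exact mul_nonneg hc (Real.rpow_nonneg hr.1.le _)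

theorem setLIntegral_Ioi_rpow {c e δ : ℝ} (hc : 0 ≤ c) (he : 0 < e) (hδ : 0 < δ) :
    ∫⁻ r in Set.Ioi δ, ENNReal.ofReal (c * r ^ (-e - 1)) =
      ENNReal.ofReal (c * δ ^ (-e) / e) := by
  have hint : IntegrableOn (fun r : ℝ => r ^ (-e - 1)) (Set.Ioi δ) :=
    integrableOn_Ioi_rpow_of_lt (by linarith) hδ
  rw [← ofReal_integral_eq_lintegral_ofReal (hint.const_mul c), integral_const_mul,
    integral_Ioi_rpow_of_lt (by linarith) hδ, sub_add_cancel, neg_div_neg_eq, mul_div_assoc]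
  filter_upwards [ae_restrict_mem measurableSet_Ioi] with r hr
  exact mul_nonneg hc (Real.rpow_nonneg (hδ.trans hr).le _)

section PowerWeights

variable {d p : ℝ} {a : ℝ → ℝ≥0∞} {A C : ℝ≥0∞}

/-- Split at `r = 1`: the bound `A` is used near the origin, and the decay `r^(-p) C` makes the tail
integrable. The tail keeps the factor `1 - s`, so it vanishes as `s → 1`. -/
theorem lintegral_power_weight_le (hd : 0 ≤ d) (hp : 0 < p)
    (hA : ∀ r, 0 < r → a r ≤ A) (hC : ∀ r, 0 < r → a r ≤ ENNReal.ofReal (r ^ (-p)) * C)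
    {s : ℝ} (hs0 : 0 < s) (hs1 : s < 1) :
    ENNReal.ofReal (1 - s) *
        ∫⁻ r in Set.Ioi 0, ENNReal.ofReal ((d + s * p) * r ^ (p * (1 - s) - 1)) * a r ≤
      ENNReal.ofReal ((d + s * p) / p) * A +
        ENNReal.ofReal ((1 - s) * ((d + s * p) / (s * p))) * C := by
  have hc : 0 ≤ d + s * p := by positivity
  have h1s : 0 < 1 - s := by linarith
  have hm : ∀ e : ℝ, Measurable fun r : ℝ => ENNReal.ofReal ((d + s * p) * r ^ e) := fun e => by
    fun_prop
  rw [← Set.Ioc_union_Ioi_eq_Ioi (zero_le_one' ℝ),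
    lintegral_union measurableSet_Ioi (Set.Ioc_disjoint_Ioi le_rfl), mul_add]
  gcongr ?_ + ?_
  · calc ENNReal.ofReal (1 - s) * ∫⁻ r in Set.Ioc 0 1,
          ENNReal.ofReal ((d + s * p) * r ^ (p * (1 - s) - 1)) * a r
        ≤ ENNReal.ofReal (1 - s) * ∫⁻ r in Set.Ioc (0 : ℝ) 1,
          ENNReal.ofReal ((d + s * p) * r ^ (p * (1 - s) - 1)) * A := by
          gcongr 1
          exact setLIntegral_mono' measurableSet_Ioc fun r hr => by gcongr; exact hA r hr.1
      _ = _ := by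
          rw [lintegral_mul_const _ (hm _), setLIntegral_Ioc_rpow hc (by positivity) zero_le_one,
            ← mul_assoc, ← ENNReal.ofReal_mul h1s.le, Real.one_rpow]
          congr 2
          field_simp
  · calc ENNReal.ofReal (1 - s) * ∫⁻ r in Set.Ioi 1,
          ENNReal.ofReal ((d + s * p) * r ^ (p * (1 - s) - 1)) * a r
        ≤ ENNReal.ofReal (1 - s) * ∫⁻ r in Set.Ioi (1 : ℝ),
          ENNReal.ofReal ((d + s * p) * r ^ (-(s * p) - 1)) * C := by
          gcongr 1
          refine setLIntegral_mono' measurableSet_Ioi fun r hr => ?_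
          have hr0 : (0 : ℝ) < r := zero_lt_one.trans hr
          calc _ ≤ ENNReal.ofReal ((d + s * p) * r ^ (p * (1 - s) - 1)) *
                (ENNReal.ofReal (r ^ (-p)) * C) := by gcongr; exact hC r hr0
            _ = _ := by
              rw [← mul_assoc, ← ENNReal.ofReal_mul (by positivity), mul_assoc (d + s * p),
                ← Real.rpow_add hr0]
              ring_nf
      _ = _ := by
          rw [lintegral_mul_const _ (hm _), setLIntegral_Ioi_rpow hc (by positivity) zero_lt_one,
            ← mul_assoc, ← ENNReal.ofReal_mul h1s.le, Real.one_rpow, mul_one]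

/-- Discard everything beyond `δ`. The remaining factor `δ^(p(1-s))` tends to `1`, so the choice of
`δ` does not affect the limit. -/
theorem le_lintegral_power_weight (hd : 0 ≤ d) (hp : 0 < p) {B : ℝ≥0∞} {δ : ℝ} (hδ : 0 < δ)
    (hB : ∀ r, 0 < r → r < δ → B ≤ a r) {s : ℝ} (hs0 : 0 < s) (hs1 : s < 1) :
    ENNReal.ofReal ((d + s * p) / p * δ ^ (p * (1 - s))) * B ≤ ENNReal.ofReal (1 - s) *
      ∫⁻ r in Set.Ioi 0, ENNReal.ofReal ((d + s * p) * r ^ (p * (1 - s) - 1)) * a r := by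
  have hc : 0 ≤ d + s * p := by positivity
  have h1s : 0 < 1 - s := by linarith
  have hm : Measurable fun r : ℝ =>
    ENNReal.ofReal ((d + s * p) * r ^ (p * (1 - s) - 1)) := by fun_prop
  calc ENNReal.ofReal ((d + s * p) / p * δ ^ (p * (1 - s))) * B
      = ENNReal.ofReal (1 - s) * ∫⁻ r in Set.Ioc (0 : ℝ) δ,
          ENNReal.ofReal ((d + s * p) * r ^ (p * (1 - s) - 1)) * B := by
        rw [lintegral_mul_const _ hm, setLIntegral_Ioc_rpow hc (by positivity) hδ.le,
            ← mul_assoc, ← ENNReal.ofReal_mul h1s.le]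
        congr 2
        field_simp
    -- The lower bound on `a` is available only for `r < δ`, hence the open interval.
    _ = ENNReal.ofReal (1 - s) * ∫⁻ r in Set.Ioo (0 : ℝ) δ,
          ENNReal.ofReal ((d + s * p) * r ^ (p * (1 - s) - 1)) * B := by
        rw [setLIntegral_congr Ioo_ae_eq_Ioc]
    _ ≤ ENNReal.ofReal (1 - s) * ∫⁻ r in Set.Ioo (0 : ℝ) δ,
          ENNReal.ofReal ((d + s * p) * r ^ (p * (1 - s) - 1)) * a r := by
        gcongr 1
        exact setLIntegral_mono' measurableSet_Ioo fun r hr => by gcongr; exact hB r hr.1 hr.2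
    _ ≤ _ := by
        gcongr
        exact Set.Ioo_subset_Ioi_self

/-- The normalized weights `(1 - s) r^{p(1-s)-1}` concentrate at `0` as `s → 1`. -/
theorem tendsto_lintegral_power_weight (hd : 0 ≤ d) (hp : 0 < p) (hAtop : A ≠ ⊤) (hCtop : C ≠ ⊤)
    (hA : ∀ r, 0 < r → a r ≤ A) (hC : ∀ r, 0 < r → a r ≤ ENNReal.ofReal (r ^ (-p)) * C)
    (hlim : Tendsto a (𝓝[>] 0) (𝓝 A)) :
    Tendsto (fun s : ℝ => ENNReal.ofReal (1 - s) *
        ∫⁻ r in Set.Ioi 0, ENNReal.ofReal ((d + s * p) * r ^ (p * (1 - s) - 1)) * a r)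
      (𝓝[<] 1) (𝓝 (ENNReal.ofReal ((d + p) / p) * A)) := by
  have hs : ∀ᶠ s : ℝ in 𝓝[<] 1, 0 < s ∧ s < 1 := Ioo_mem_nhdsLT zero_lt_one
  refine tendsto_of_le_liminf_of_limsup_le ?_ ?_
  · refine ENNReal.mul_le_of_forall_lt fun c hc B hB => ?_
    obtain ⟨δ, hδ, hδB⟩ := mem_nhdsGT_iff_exists_Ioo_subset.1 (hlim.eventually_const_lt hB)
    have h1 : Tendsto (fun s : ℝ => ENNReal.ofReal ((d + s * p) / p * δ ^ (p * (1 - s))) * B)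
        (𝓝[<] 1) (𝓝 (ENNReal.ofReal ((d + 1 * p) / p * δ ^ (p * (1 - 1) : ℝ)) * B)) := by
      refine ENNReal.Tendsto.mul_const (ENNReal.tendsto_ofReal ?_)
        (Or.inr (hB.trans_le le_top).ne)
      have : Continuous fun s : ℝ => (d + s * p) / p * δ ^ (p * (1 - s)) := by
        refine Continuous.mul (by fun_prop) ?_
        exact Continuous.rpow continuous_const (by fun_prop) fun _ => Or.inl (ne_of_gt hδ)
      exact (this.tendsto 1).mono_left nhdsWithin_le_nhds
    simp only [sub_self, mul_zero, Real.rpow_zero, mul_one, one_mul] at h1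
    calc c * B ≤ ENNReal.ofReal ((d + p) / p) * B := by gcongr
      _ = _ := h1.liminf_eq.symm
      _ ≤ _ := by
        refine liminf_le_liminf ?_
        filter_upwards [hs] with s hs
        exact le_lintegral_power_weight hd hp hδ (fun r h1 h2 => le_of_lt (hδB ⟨h1, h2⟩)) hs.1 hs.2
  · have h1 : Tendsto (fun s : ℝ => ENNReal.ofReal ((d + s * p) / p) * A +
        ENNReal.ofReal ((1 - s) * ((d + s * p) / (s * p))) * C)
        (𝓝[<] 1) (𝓝 (ENNReal.ofReal ((d + 1 * p) / p) * A +
          ENNReal.ofReal ((1 - 1) * ((d + 1 * p) / (1 * p))) * C)) := by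
      refine Tendsto.add ?_ ?_
      · refine ENNReal.Tendsto.mul_const (ENNReal.tendsto_ofReal ?_) (Or.inr hAtop)
        have : Continuous fun s : ℝ => (d + s * p) / p := by fun_prop
        exact (this.tendsto 1).mono_left nhdsWithin_le_nhds
      · refine ENNReal.Tendsto.mul_const (ENNReal.tendsto_ofReal ?_) (Or.inr hCtop)
        have : ContinuousAt (fun s : ℝ => (1 - s) * ((d + s * p) / (s * p))) 1 := by
          refine ContinuousAt.mul (by fun_prop) (ContinuousAt.div (by fun_prop) (by fun_prop) ?_)
          simpa using hp.ne'
        exact this.tendsto.mono_left nhdsWithin_le_nhds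
    simp only [sub_self, zero_mul, one_mul, ENNReal.ofReal_zero, add_zero] at h1
    calc _ ≤ limsup _ _ := limsup_le_limsup (by
            filter_upwards [hs] with s hs
            exact lintegral_power_weight_le hd hp hA hC hs.1 hs.2)
      _ = _ := h1.limsup_eq

end PowerWeights

/-! ### Layer-cake form of the Gagliardo integral -/

section LayerCake

theorem lintegral_comp_smul_addHaar {E : Type*} [NormedAddCommGroup E] [NormedSpace ℝ E]
    [FiniteDimensional ℝ E] [MeasurableSpace E] [BorelSpace E] {μ : Measure E}
    [μ.IsAddHaarMeasure] {F : E → ℝ≥0∞} {r : ℝ} (hr : 0 < r) :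
    ∫⁻ h, F h ∂μ = ENNReal.ofReal (r ^ Module.finrank ℝ E) * ∫⁻ h, F (r • h) ∂μ := by
  have h1 : ∫⁻ h, F (r • h) ∂μ = ∫⁻ h, F h ∂(μ.map (r • ·)) :=
    ((Homeomorph.smulOfNeZero r hr.ne').measurableEmbedding.lintegral_map F).symm
  rw [h1, Measure.map_addHaar_smul μ hr.ne', lintegral_smul_measure, smul_eq_mul, ← mul_assoc,
    ← ENNReal.ofReal_mul (by positivity), abs_of_pos (by positivity),
    mul_inv_cancel₀ (by positivity), ENNReal.ofReal_one, one_mul]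

theorem ofReal_one_div_rpow_eq_lintegral {q t : ℝ} (hq : 0 < q) (ht : 0 < t) :
    ENNReal.ofReal (1 / t ^ q) = ∫⁻ r in Set.Ioi (0 : ℝ),
      (Set.Ici t).indicator (fun r => ENNReal.ofReal (q * r ^ (-q - 1))) r := by
  rw [lintegral_indicator measurableSet_Ici, Measure.restrict_restrict measurableSet_Ici,
    Set.inter_eq_left.2 (Set.Ici_subset_Ioi.2 ht), setLIntegral_congr Ioi_ae_eq_Ici.symm]
  have hint : IntegrableOn (fun r : ℝ => r ^ (-q - 1)) (Set.Ioi t) :=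
    integrableOn_Ioi_rpow_of_lt (by linarith) ht
  rw [← ofReal_integral_eq_lintegral_ofReal (hint.const_mul q), integral_const_mul,
    integral_Ioi_rpow_of_lt (by linarith) ht, sub_add_cancel, neg_div_neg_eq,
    mul_div_cancel₀ _ hq.ne', Real.rpow_neg ht.le, one_div]
  filter_upwards [ae_restrict_mem measurableSet_Ioi] with r hr
  exact mul_nonneg hq.le (Real.rpow_nonneg (ht.trans hr).le _)

variable {n : ℕ} {p : ℝ} {f : Rn n → ℝ} {N : Rn n → ℝ}

theorem measurable_enorm_sub_translate_rpow (hf : Measurable f) (p : ℝ) :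
    Measurable fun z : Rn n × Rn n => ‖f (z.2 + z.1) - f z.2‖ₑ ^ p :=
  ((hf.comp (by fun_prop)).sub (hf.comp measurable_snd)).enorm.pow_const p

theorem measurable_sub_translate_rpow (hf : Measurable f) (p : ℝ) (h : Rn n) :
    Measurable fun x => ‖f (x + h) - f x‖ₑ ^ p :=
  ((hf.comp (measurable_add_const h)).sub hf).enorm.pow_const p

theorem measurable_lintegral_sub_translate (hf : Measurable f) (p : ℝ) :
    Measurable fun h => ∫⁻ x, ‖f (x + h) - f x‖ₑ ^ p :=
  (measurable_enorm_sub_translate_rpow hf p).lintegral_prod_right'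

theorem gagliardo_eq_lintegral_translate (hp : 0 ≤ p) (s : ℝ) (hf : Measurable f)
    (hN : Measurable N) :
    gagliardo p s N f = ∫⁻ h, ENNReal.ofReal (1 / N h ^ ((n : ℝ) + s * p)) *
      ∫⁻ x, ‖f (x + h) - f x‖ₑ ^ p := by
  have hm : Measurable fun z : Rn n × Rn n => ‖f (z.1 + z.2) - f z.1‖ₑ ^ p :=
    ((hf.comp measurable_add).sub (hf.comp measurable_fst)).enorm.pow_const p
  have hNm : Measurable fun h => ENNReal.ofReal (1 / N h ^ ((n : ℝ) + s * p)) := by fun_prop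
  calc gagliardo p s N f
      = ∫⁻ y, ∫⁻ h, ENNReal.ofReal (1 / N h ^ ((n : ℝ) + s * p)) * ‖f (y + h) - f y‖ₑ ^ p := by
        unfold gagliardo
        congr 1 with y
        rw [← lintegral_add_right_eq_self _ y]
        congr 1 with h
        rw [add_sub_cancel_right, add_comm h y, div_eq_mul_one_div, mul_comm,
          ENNReal.ofReal_mul' (by positivity), ofReal_abs_rpow_eq_enorm_rpow hp]
    _ = ∫⁻ h, ∫⁻ y, ENNReal.ofReal (1 / N h ^ ((n : ℝ) + s * p)) * ‖f (y + h) - f y‖ₑ ^ p := by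
        refine lintegral_lintegral_swap (Measurable.aemeasurable ?_)
        exact (hNm.comp measurable_snd).mul hm
    _ = _ := by
        congr 1 with h
        exact lintegral_const_mul _ (measurable_sub_translate_rpow hf p h)

/-- The kernel is written as an integral over the levels `r ≥ N h`, and Tonelli exchanges `h` with
`r`. Positivity of `N` almost everywhere is what makes the kernel formula applicable. -/
theorem gagliardo_eq_lintegral_sublevel (hp : 0 ≤ p) {s : ℝ} (hq : 0 < (n : ℝ) + s * p)
    (hf : Measurable f) (hN : Measurable N) (hpos : ∀ᵐ h, 0 < N h) :
    gagliardo p s N f = ∫⁻ r in Set.Ioi (0 : ℝ),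
      ENNReal.ofReal (((n : ℝ) + s * p) * r ^ (-((n : ℝ) + s * p) - 1)) *
        ∫⁻ h in {h | N h ≤ r}, ∫⁻ x, ‖f (x + h) - f x‖ₑ ^ p := by
  set q := (n : ℝ) + s * p
  have hω := measurable_lintegral_sub_translate hf p
  have hset : MeasurableSet {z : Rn n × ℝ | N z.1 ≤ z.2} :=
    measurableSet_le (hN.comp measurable_fst) measurable_snd
  have hw : Measurable fun r : ℝ => ENNReal.ofReal (q * r ^ (-q - 1)) := by fun_prop
  rw [gagliardo_eq_lintegral_translate hp s hf hN]
  calc ∫⁻ h, ENNReal.ofReal (1 / N h ^ q) * ∫⁻ x, ‖f (x + h) - f x‖ₑ ^ p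
      = ∫⁻ h, ∫⁻ r in Set.Ioi (0 : ℝ), {z : Rn n × ℝ | N z.1 ≤ z.2}.indicator
          (fun z => ENNReal.ofReal (q * z.2 ^ (-q - 1)) *
            ∫⁻ x, ‖f (x + z.1) - f x‖ₑ ^ p) (h, r) := by
        refine lintegral_congr_ae ?_
        filter_upwards [hpos] with h hh
        rw [ofReal_one_div_rpow_eq_lintegral hq hh,
          ← lintegral_mul_const _ (hw.indicator measurableSet_Ici)]
        congr 1 with r
        by_cases hr : N h ≤ r <;> simp [Set.indicator, hr]
    _ = ∫⁻ r in Set.Ioi (0 : ℝ), ∫⁻ h, {z : Rn n × ℝ | N z.1 ≤ z.2}.indicator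
          (fun z => ENNReal.ofReal (q * z.2 ^ (-q - 1)) *
            ∫⁻ x, ‖f (x + z.1) - f x‖ₑ ^ p) (h, r) := by
        refine lintegral_lintegral_swap (Measurable.aemeasurable ?_)
        exact ((hw.comp measurable_snd).mul (hω.comp measurable_fst)).indicator hset
    _ = _ := by
        congr 1 with r
        rw [← lintegral_indicator (measurableSet_le hN measurable_const),
          ← lintegral_const_mul _ (hω.indicator (measurableSet_le hN measurable_const))]
        congr 1 with h
        by_cases hr : N h ≤ r <;> simp [Set.indicator, hr]

/-- The dilation `h ↦ r h` contributes `r^n` and passing to difference quotients contributes `r^p`,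
so the exponent becomes `-(n+sp) - 1 + n + p = p(1-s) - 1`. -/
theorem gagliardo_eq_lintegral_difference_quotient (hp : 0 ≤ p) {s : ℝ}
    (hq : 0 < (n : ℝ) + s * p) (hf : Measurable f) (hN : Measurable N) (hpos : ∀ᵐ h, 0 < N h)
    (hhom : ∀ r : ℝ, 0 < r → ∀ h, N (r • h) = r * N h) :
    gagliardo p s N f = ∫⁻ r in Set.Ioi (0 : ℝ),
      ENNReal.ofReal (((n : ℝ) + s * p) * r ^ (p * (1 - s) - 1)) *
        ∫⁻ h in {h | N h ≤ 1}, ∫⁻ x, ‖r⁻¹ * (f (x + r • h) - f x)‖ₑ ^ p := by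
  rw [gagliardo_eq_lintegral_sublevel hp hq hf hN hpos]
  refine setLIntegral_congr_fun measurableSet_Ioi fun r (hr : 0 < r) => ?_
  have hω : Measurable fun h => ∫⁻ x, ‖f (x + r • h) - f x‖ₑ ^ p :=
    (measurable_lintegral_sub_translate hf p).comp (measurable_const_smul r)
  have hK : ∀ h, N (r • h) ≤ r ↔ N h ≤ 1 := fun h => by
    rw [hhom r hr, mul_le_iff_le_one_right hr]
  have h1 : ∫⁻ h in {h | N h ≤ r}, ∫⁻ x, ‖f (x + h) - f x‖ₑ ^ p =
      ENNReal.ofReal (r ^ n) *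
        ∫⁻ h in {h | N h ≤ 1}, ∫⁻ x, ‖f (x + r • h) - f x‖ₑ ^ p := by
    rw [← lintegral_indicator (measurableSet_le hN measurable_const),
      ← lintegral_indicator (measurableSet_le hN measurable_const),
      lintegral_comp_smul_addHaar hr, finrank_euclideanSpace_fin]
    congr 2 with h
    by_cases hh : N h ≤ 1 <;> simp [Set.indicator, hK, hh]
  have h2 : ∀ h, ∫⁻ x, ‖r⁻¹ * (f (x + r • h) - f x)‖ₑ ^ p =
      ENNReal.ofReal (r ^ (-p)) * ∫⁻ x, ‖f (x + r • h) - f x‖ₑ ^ p := by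
    intro h
    simp only [enorm_mul, ENNReal.mul_rpow_of_nonneg _ _ hp]
    rw [lintegral_const_mul _ (measurable_sub_translate_rpow hf p _),
      ← ofReal_abs_rpow_eq_enorm_rpow hp, abs_of_pos (inv_pos.2 hr),
      Real.inv_rpow hr.le, Real.rpow_neg hr.le]
  simp only [h1, h2]
  rw [lintegral_const_mul _ hω, ← mul_assoc, ← mul_assoc,
    ← ENNReal.ofReal_mul (by positivity), ← ENNReal.ofReal_mul (by positivity),
    ← Real.rpow_natCast, mul_assoc, mul_assoc, ← Real.rpow_add hr, ← Real.rpow_add hr]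
  ring_nf

end LayerCake

/-! ### The polar moment norm and the Euclidean constant -/

section PolarMoment

/-- Integration over the unit ball in polar coordinates, for a function homogeneous of degree
`p`. -/
theorem setIntegral_closedBall_eq_toSphere {E : Type*} [NormedAddCommGroup E] [NormedSpace ℝ E]
    [FiniteDimensional ℝ E] [Nontrivial E] [MeasurableSpace E] [BorelSpace E] (μ : Measure E)
    [μ.IsAddHaarMeasure] {p : ℝ} (hp : 0 < p) {F : E → ℝ}
    (hF : ∀ r : ℝ, 0 < r → ∀ x, F (r • x) = r ^ p * F x) :
    ((Module.finrank ℝ E : ℝ) + p) * ∫ x in Metric.closedBall 0 1, F x ∂μ =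
      ∫ u : Metric.sphere (0 : E) 1, F u ∂μ.toSphere := by
  set d := Module.finrank ℝ E with hd
  have hdpos : 0 < d := Module.finrank_pos
  have hdpos' : (0 : ℝ) < d := by exact_mod_cast hdpos
  have hd1 : ((d - 1 : ℕ) : ℝ) = d - 1 := by
    rw [Nat.cast_sub hdpos, Nat.cast_one]
  -- In polar coordinates the integrand times the indicator of the ball is a product of this radial
  -- profile and `F` on the sphere.
  set w : ℝ → ℝ := (Set.Iic 1).indicator fun r => r ^ p with hw
  have hradial : ∫ r : Set.Ioi (0 : ℝ), w r ∂(Measure.volumeIoiPow (d - 1)) =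
      1 / ((d : ℝ) + p) := by
    simp only [Measure.volumeIoiPow, ENNReal.ofReal]
    rw [integral_withDensity_eq_integral_smul (measurable_subtype_coe.pow_const _).real_toNNReal,
      integral_subtype_comap measurableSet_Ioi
        fun a : ℝ => Real.toNNReal (a ^ (d - 1)) • w a]
    have h1 : ∫ r in Set.Ioi (0 : ℝ), Real.toNNReal (r ^ (d - 1)) • w r =
        ∫ r in Set.Ioi (0 : ℝ), (Set.Iic 1).indicator (fun r => r ^ ((d : ℝ) - 1 + p)) r := by
      refine setIntegral_congr_fun measurableSet_Ioi fun r (hr : 0 < r) => ?_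
      simp only [NNReal.smul_def, Real.coe_toNNReal _ (pow_nonneg hr.le _), smul_eq_mul, hw]
      by_cases hr1 : r ≤ 1
      · simp only [Set.indicator, Set.mem_Iic, hr1, if_true]
        rw [Real.rpow_add hr, ← hd1, Real.rpow_natCast]
      · simp [Set.indicator, hr1]
    rw [h1, setIntegral_indicator measurableSet_Iic, Set.Ioi_inter_Iic,
      ← intervalIntegral.integral_of_le zero_le_one, integral_rpow]
    · rw [Real.one_rpow, Real.zero_rpow (by linarith)]
      ring_nf
    · left
      linarith
  -- Polar coordinates live on the punctured space; the origin is a null set.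
  have hpunct : ∀ G : E → ℝ, ∫ x, G x ∂μ = ∫ x : ({0}ᶜ : Set E), G x ∂(μ.comap (↑)) := fun G => by
    rw [integral_subtype_comap (measurableSet_singleton _).compl, restrict_compl_singleton]
  have hmain : ∫ x in Metric.closedBall 0 1, F x ∂μ =
      (∫ u : Metric.sphere (0 : E) 1, F u ∂μ.toSphere) * (1 / ((d : ℝ) + p)) := by
    rw [← hradial, ← integral_prod_mul, ← integral_indicator measurableSet_closedBall,
      ← μ.measurePreserving_homeomorphUnitSphereProd.integral_comp
        (Homeomorph.measurableEmbedding _), hpunct]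
    congr 1 with x
    have hx : 0 < ‖(x : E)‖ := norm_pos_iff.2 x.2
    have h2 : F (x : E) = ‖(x : E)‖ ^ p * F (‖(x : E)‖⁻¹ • (x : E)) := by
      rw [← hF _ hx, smul_smul, mul_inv_cancel₀ hx.ne', one_smul]
    by_cases hx1 : ‖(x : E)‖ ≤ 1
    · simp [Set.indicator, hx1, hw, h2, mul_comm]
    · simp [Set.indicator, hx1, hw]
  have : (0 : ℝ) < d + p := by positivity
  rw [hmain]
  field_simp

variable {n : ℕ} {p : ℝ}

theorem polarMomentPow_smul (K : Set (Rn n)) {r : ℝ} (hr : 0 ≤ r) (v : Rn n) :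
    polarMomentPow p K (r • v) = r ^ p * polarMomentPow p K v := by
  unfold polarMomentPow
  have h : ∀ x : Rn n, |⟪r • v, x⟫| ^ p = r ^ p * |⟪v, x⟫| ^ p := fun x => by
    rw [real_inner_smul_left, abs_mul, abs_of_nonneg hr, Real.mul_rpow hr (abs_nonneg _)]
  simp_rw [h]
  rw [integral_const_mul]
  ring

theorem polarMomentPow_closedBall_map (T : Rn n ≃ₗᵢ[ℝ] Rn n) (v : Rn n) :
    polarMomentPow p (Metric.closedBall 0 1) (T v) =
      polarMomentPow p (Metric.closedBall 0 1) v := by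
  unfold polarMomentPow
  congr 1
  have h := T.measurePreserving.setIntegral_preimage_emb T.toHomeomorph.measurableEmbedding
    (fun x => |⟪T v, x⟫| ^ p) (Metric.closedBall 0 1)
  rw [← h]
  simp [LinearIsometryEquiv.inner_map_map]

/-- A reflection carries `v` to `‖v‖ • e`, two vectors of equal length, and it preserves both the
ball and Lebesgue measure; homogeneity then extracts `‖v‖ ^ p`. -/
theorem polarMomentPow_closedBall {e : Rn n} (he : ‖e‖ = 1) (v : Rn n) :
    polarMomentPow p (Metric.closedBall 0 1) v =
      ‖v‖ ^ p * polarMomentPow p (Metric.closedBall 0 1) e := by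
  have h : ‖v‖ = ‖‖v‖ • e‖ := by simp [norm_smul, he]
  rw [← polarMomentPow_smul _ (norm_nonneg v), ← Submodule.reflection_sub h,
    polarMomentPow_closedBall_map]

theorem polarMomentPow_closedBall_eq_toSphere (hn : 1 ≤ n) (hp : 0 < p) (e : Rn n) :
    polarMomentPow p (Metric.closedBall 0 1) e =
      1 / p * ∫ u : Metric.sphere (0 : Rn n) 1, |⟪e, (u : Rn n)⟫| ^ p
        ∂(volume : Measure (Rn n)).toSphere := by
  have : Nonempty (Fin n) := ⟨⟨0, hn⟩⟩
  rw [← setIntegral_closedBall_eq_toSphere volume hp (F := fun x => |⟪e, x⟫| ^ p),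
    finrank_euclideanSpace_fin, polarMomentPow]
  · ring
  · intro r hr x
    rw [inner_smul_right, abs_mul, abs_of_pos hr, Real.mul_rpow hr.le (abs_nonneg _)]

theorem ofReal_polarMomentPow (hp : 0 < p) {K : Set (Rn n)} (hK : IsCompact K) (v : Rn n) :
    ENNReal.ofReal (polarMomentPow p K v) =
      ENNReal.ofReal (((n : ℝ) + p) / p) * ∫⁻ h in K, ‖⟪v, h⟫‖ₑ ^ p := by
  have hc : Continuous fun x : Rn n => |⟪v, x⟫| ^ p :=
    Continuous.rpow_const (by fun_prop) fun _ => Or.inr hp.le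
  rw [polarMomentPow, ENNReal.ofReal_mul (by positivity),
    ofReal_integral_eq_lintegral_ofReal (hc.continuousOn.integrableOn_compact hK)
      (Eventually.of_forall fun x => by positivity)]
  simp_rw [ofReal_abs_rpow_eq_enorm_rpow hp.le]

theorem gagliardo_congr {s : ℝ} {N : Rn n → ℝ} {f f' : Rn n → ℝ} (h : f =ᵐ[volume] f') :
    gagliardo p s N f = gagliardo p s N f' := by
  unfold gagliardo
  refine lintegral_congr_ae ?_
  filter_upwards [h] with y hy
  refine lintegral_congr_ae ?_
  filter_upwards [h] with x hx
  rw [hx, hy]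

end PolarMoment

/-! ### Passage to the limit -/

section Limit

variable {n : ℕ} {p : ℝ} {f : Rn n → ℝ} {g : Rn n → Rn n}

theorem measurable_enorm_inner_rpow (hg : Measurable g) (p : ℝ) :
    Measurable fun z : Rn n × Rn n => ‖⟪g z.2, z.1⟫‖ₑ ^ p :=
  ((hg.comp measurable_snd).inner measurable_fst).enorm.pow_const p

theorem setLIntegral_inner_rpow_lt_top (hp : 0 < p) (hg : Measurable g)
    (hgp : MemLp g (ENNReal.ofReal p)) {K : Set (Rn n)} (hK : IsCompact K) :
    ∫⁻ h in K, ∫⁻ x, ‖⟪g x, h⟫‖ₑ ^ p < ⊤ := by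
  obtain ⟨R, hR⟩ := hK.isBounded.exists_norm_le
  have hG : ∫⁻ x, ‖g x‖ₑ ^ p < ⊤ := by
    rw [lintegral_enorm_rpow_eq_eLpNorm_rpow hp]
    exact ENNReal.rpow_lt_top_of_nonneg hp.le hgp.2.ne
  calc ∫⁻ h in K, ∫⁻ x, ‖⟪g x, h⟫‖ₑ ^ p
      ≤ ∫⁻ h in K, (∫⁻ x, ‖g x‖ₑ ^ p) * ENNReal.ofReal R ^ p := by
        refine setLIntegral_mono' hK.measurableSet fun h hh => ?_
        rw [← lintegral_mul_const _ (hg.enorm.pow_const p)]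
        refine lintegral_mono fun x => ?_
        rw [← ENNReal.mul_rpow_of_nonneg _ _ hp.le]
        gcongr
        calc ‖⟪g x, h⟫‖ₑ ≤ ‖g x‖ₑ * ‖h‖ₑ := by
              rw [← ofReal_norm, ← ofReal_norm, ← ofReal_norm,
                ← ENNReal.ofReal_mul (norm_nonneg _)]
              exact ENNReal.ofReal_le_ofReal (norm_inner_le_norm _ _)
          _ ≤ ‖g x‖ₑ * ENNReal.ofReal R := by
              gcongr
              rw [← ofReal_norm]
              exact ENNReal.ofReal_le_ofReal (hR h hh)
    _ < ⊤ := by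
        rw [setLIntegral_const]
        exact ENNReal.mul_lt_top (ENNReal.mul_lt_top hG
          (ENNReal.rpow_lt_top_of_nonneg hp.le ENNReal.ofReal_ne_top)) hK.measure_lt_top

/-- The triangle inequality alone, with no gradient: this is the decay in `r` that controls the tail
of the weighted integral. -/
theorem lintegral_difference_quotient_le_eLpNorm (hp : 1 ≤ p) (hf : Measurable f) (h : Rn n)
    {r : ℝ} (hr : 0 < r) :
    ∫⁻ x, ‖r⁻¹ * (f (x + r • h) - f x)‖ₑ ^ p ≤
      ENNReal.ofReal (r ^ (-p)) * (2 * eLpNorm f (ENNReal.ofReal p) volume) ^ p := by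
  have hp0 : 0 < p := by linarith
  have htr : Measurable fun x => f (x + r • h) := hf.comp (measurable_add_const _)
  have hshift : eLpNorm (fun x => f (x + r • h)) (ENNReal.ofReal p) volume =
      eLpNorm f (ENNReal.ofReal p) volume :=
    eLpNorm_comp_measurePreserving hf.aestronglyMeasurable
      (measurePreserving_add_right volume (r • h))
  simp only [enorm_mul, ENNReal.mul_rpow_of_nonneg _ _ hp0.le]
  rw [lintegral_const_mul _ (measurable_sub_translate_rpow hf p _),
    ← ofReal_abs_rpow_eq_enorm_rpow hp0.le, abs_of_pos (inv_pos.2 hr), Real.inv_rpow hr.le,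
    Real.rpow_neg hr.le, lintegral_enorm_rpow_eq_eLpNorm_rpow hp0,
    ← ENNReal.mul_rpow_of_nonneg _ _ hp0.le]
  gcongr
  calc _ ≤ eLpNorm (fun x => f (x + r • h)) (ENNReal.ofReal p) volume +
        eLpNorm f (ENNReal.ofReal p) volume :=
        eLpNorm_sub_le htr.aestronglyMeasurable hf.aestronglyMeasurable (by simpa using hp)
    _ = _ := by rw [hshift, two_mul]

theorem measurable_lintegral_difference_quotient (hf : Measurable f) (p r : ℝ) :
    Measurable fun h => ∫⁻ x, ‖r⁻¹ * (f (x + r • h) - f x)‖ₑ ^ p := by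
  have : Measurable fun z : Rn n × Rn n => ‖r⁻¹ * (f (z.2 + r • z.1) - f z.2)‖ₑ ^ p :=
    (((hf.comp (by fun_prop)).sub (hf.comp measurable_snd)).const_mul _).enorm.pow_const p
  exact this.lintegral_prod_right'

/-- Dominated convergence in `h`; the limit function itself is the dominating function, since the
gradient bound holds for every `r > 0`. -/
theorem HasWeakGradient.tendsto_setLIntegral_difference_quotient
    (hg : HasWeakGradient f g) (hfm : Measurable f) (hgm : Measurable g)
    (hgp : MemLp g (ENNReal.ofReal p)) (hp : 1 ≤ p) {K : Set (Rn n)} (hK : IsCompact K) :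
    Tendsto (fun r : ℝ => ∫⁻ h in K, ∫⁻ x, ‖r⁻¹ * (f (x + r • h) - f x)‖ₑ ^ p) (𝓝[>] 0)
      (𝓝 (∫⁻ h in K, ∫⁻ x, ‖⟪g x, h⟫‖ₑ ^ p)) := by
  refine tendsto_lintegral_filter_of_dominated_convergence
    (fun h => ∫⁻ x, ‖⟪g x, h⟫‖ₑ ^ p) ?_ ?_
    (setLIntegral_inner_rpow_lt_top (by linarith) hgm hgp hK).ne ?_
  · exact Eventually.of_forall fun r => measurable_lintegral_difference_quotient hfm p r
  · filter_upwards [self_mem_nhdsWithin] with r hr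
    exact Eventually.of_forall fun h => hg.lintegral_difference_quotient_le hfm hgm hp h hr
  · exact Eventually.of_forall fun h =>
      hg.tendsto_lintegral_difference_quotient hfm hgm hgp hp h

theorem HasWeakGradient.tendsto_gagliardo
    (hg : HasWeakGradient f g) (hfm : Measurable f) (hgm : Measurable g)
    (hfp : MemLp f (ENNReal.ofReal p)) (hgp : MemLp g (ENNReal.ofReal p)) (hp : 1 ≤ p)
    {N : Rn n → ℝ} (hN : Measurable N) (hpos : ∀ᵐ h, 0 < N h)
    (hhom : ∀ r : ℝ, 0 < r → ∀ h, N (r • h) = r * N h) (hK : IsCompact {h | N h ≤ 1}) :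
    Tendsto (fun s : ℝ => ENNReal.ofReal (1 - s) * gagliardo p s N f) (𝓝[<] 1)
      (𝓝 (ENNReal.ofReal (((n : ℝ) + p) / p) *
        ∫⁻ h in {h | N h ≤ 1}, ∫⁻ x, ‖⟪g x, h⟫‖ₑ ^ p)) := by
  have hp0 : 0 < p := by linarith
  have key := tendsto_lintegral_power_weight (d := n) (p := p)
    (a := fun r => ∫⁻ h in {h | N h ≤ 1}, ∫⁻ x, ‖r⁻¹ * (f (x + r • h) - f x)‖ₑ ^ p)
    (A := ∫⁻ h in {h | N h ≤ 1}, ∫⁻ x, ‖⟪g x, h⟫‖ₑ ^ p)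
    (C := (2 * eLpNorm f (ENNReal.ofReal p) volume) ^ p * volume {h | N h ≤ 1})
    (by positivity) hp0
    (setLIntegral_inner_rpow_lt_top hp0 hgm hgp hK).ne
    (ENNReal.mul_ne_top (ENNReal.rpow_ne_top_of_nonneg hp0.le
      (ENNReal.mul_ne_top (by simp) hfp.2.ne)) hK.measure_lt_top.ne)
    (fun r hr => lintegral_mono fun h => hg.lintegral_difference_quotient_le hfm hgm hp h hr)
    (fun r hr => by
      rw [← mul_assoc, ← setLIntegral_const]
      exact lintegral_mono fun h => lintegral_difference_quotient_le_eLpNorm hp hfm h hr)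
    (hg.tendsto_setLIntegral_difference_quotient hfm hgm hgp hp hK)
  refine key.congr' ?_
  filter_upwards [Ioo_mem_nhdsLT zero_lt_one] with s hs
  have hs0 : 0 < s := hs.1
  rw [gagliardo_eq_lintegral_difference_quotient hp0.le (by positivity) hfm hN hpos hhom]

/-- The anisotropic Bourgain–Brezis–Mironescu limit for measurable representatives. -/
theorem HasWeakGradient.tendsto_gagliardo_gauge (hn : 1 ≤ n)
    (hg : HasWeakGradient f g) (hfm : Measurable f) (hgm : Measurable g)
    (hfp : MemLp f (ENNReal.ofReal p)) (hgp : MemLp g (ENNReal.ofReal p)) (hp : 1 ≤ p)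
    {K : Set (Rn n)} (hc : Convex ℝ K) (hK : IsCompact K) (h0 : K ∈ 𝓝 0) :
    (∫⁻ x, ENNReal.ofReal (gauge (polarMomentBody p K) (g x) ^ p)) < ⊤ ∧
      Tendsto (fun s : ℝ => ENNReal.ofReal (1 - s) * gagliardo p s (gauge K) f) (𝓝[<] 1)
        (𝓝 (∫⁻ x, ENNReal.ofReal (gauge (polarMomentBody p K) (g x) ^ p))) := by
  have hp0 : 0 < p := by linarith
  have hsub : {h | gauge K h ≤ 1} = K := by
    ext h
    rw [Set.mem_ofPred_eq, gauge_le_one_iff_mem_closure hc h0, hK.isClosed.closure_eq]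
  have heq : ∫⁻ x, ENNReal.ofReal (gauge (polarMomentBody p K) (g x) ^ p) =
      ENNReal.ofReal (((n : ℝ) + p) / p) * ∫⁻ h in K, ∫⁻ x, ‖⟪g x, h⟫‖ₑ ^ p := by
    -- Tonelli exchanges `h` and `x`; for fixed `x` the inner integral over `K` is the moment of `K`
    -- in direction `g x`.
    have hm := measurable_enorm_inner_rpow hgm p
    rw [lintegral_lintegral_swap hm.aemeasurable,
      ← lintegral_const_mul' _ _ ENNReal.ofReal_ne_top]
    congr 1 with x
    rw [gauge_polarMomentBody_rpow hp, ofReal_polarMomentPow hp0 hK]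
  rw [heq]
  refine ⟨ENNReal.mul_lt_top ENNReal.ofReal_lt_top
    (setLIntegral_inner_rpow_lt_top hp0 hgm hgp hK), ?_⟩
  -- Positive dimension makes the origin, the only zero of the gauge, a null set.
  have : Nonempty (Fin n) := ⟨⟨0, hn⟩⟩
  have hpos : ∀ᵐ h : Rn n, 0 < gauge K h := by
    filter_upwards [compl_mem_ae_iff.2 (measure_singleton (μ := (volume : Measure (Rn n))) 0)]
      with h hh
    exact (gauge_pos (absorbent_nhds_zero h0) (NormedSpace.isVonNBounded_of_isBounded ℝ
      hK.isBounded)).2 hh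
  have := hg.tendsto_gagliardo hfm hgm hfp hgp hp (continuous_gauge hc h0).measurable hpos
    (fun r hr h => gauge_smul_of_nonneg hr.le h) (by rwa [hsub])
  rwa [hsub] at this

end Limit

/-- The origin is the midpoint of an interior point and its reflection in `K`, hence interior. -/
theorem Convex.mem_nhds_zero_of_symmetric {E : Type*} [NormedAddCommGroup E] [NormedSpace ℝ E]
    {K : Set E} (hc : Convex ℝ K) (hsymm : ∀ x ∈ K, -x ∈ K) (hne : (interior K).Nonempty) :
    K ∈ 𝓝 0 := by
  obtain ⟨x, hx⟩ := hne
  rw [← mem_interior_iff_mem_nhds]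
  have := hc.combo_interior_self_mem_interior hx (hsymm x (interior_subset hx))
    (a := 1 / 2) (b := 1 / 2) (by norm_num) (by norm_num) (by norm_num)
  simpa using this

theorem theorem1 (n : ℕ) (hn : 1 ≤ n) (p : ℝ) (hp : 1 ≤ p)
    (f : Rn n → ℝ) (hf : MemW1p p f) (hsupp : HasCompactEssSupport f)
    (g : Rn n → Rn n) (hg : HasWeakGradient f g) :
    (∀ K : ConvexBody (Rn n), (∀ x ∈ K, -x ∈ K) → (interior (K : Set (Rn n))).Nonempty →
      (∫⁻ x, ENNReal.ofReal (gauge (polarMomentBody p (K : Set (Rn n))) (g x) ^ p)) < ⊤ ∧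
      Tendsto (fun s : ℝ => ENNReal.ofReal (1 - s) * gagliardo p s (gauge (K : Set (Rn n))) f)
        (𝓝[<] 1)
        (𝓝 (∫⁻ x, ENNReal.ofReal (gauge (polarMomentBody p (K : Set (Rn n))) (g x) ^ p)))) ∧
    (∀ e : Rn n, ‖e‖ = 1 →
      Tendsto (fun s : ℝ => ENNReal.ofReal (1 - s) * gagliardo p s (fun z => ‖z‖) f)
        (𝓝[<] 1)
        (𝓝 (ENNReal.ofReal
            (1 / p * ∫ u : Metric.sphere (0 : Rn n) 1, |⟪e, (u : Rn n)⟫| ^ p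
              ∂(volume : Measure (Rn n)).toSphere) *
          ∫⁻ x, ENNReal.ofReal (‖g x‖ ^ p)))) := by

  have hp0 : 0 < p := by linarith
  obtain ⟨hfp, g₀, hg₀, hg₀p⟩ := hf
  -- The Sobolev hypothesis supplies some gradient in `L^p`; uniqueness transfers integrability to
  -- the given `g`.
  have hgp : MemLp g (ENNReal.ofReal p) := hg₀p.ae_eq (hg₀.ae_eq hg)
  -- Measurable representatives suffice, as both sides of the limit depend only on almost-everywhere
  -- classes.
  obtain ⟨f', hf'm, hff'⟩ := hfp.1.aemeasurable
  obtain ⟨g', hg'm, hgg'⟩ := hgp.1.aemeasurable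
  have hg' := hg.congr hff' hgg'
  have main : ∀ K : Set (Rn n), Convex ℝ K → IsCompact K → K ∈ 𝓝 0 →
      (∫⁻ x, ENNReal.ofReal (gauge (polarMomentBody p K) (g x) ^ p)) < ⊤ ∧
      Tendsto (fun s : ℝ => ENNReal.ofReal (1 - s) * gagliardo p s (gauge K) f) (𝓝[<] 1)
        (𝓝 (∫⁻ x, ENNReal.ofReal (gauge (polarMomentBody p K) (g x) ^ p))) := by
    intro K hc hK h0
    have h1 : ∫⁻ x, ENNReal.ofReal (gauge (polarMomentBody p K) (g x) ^ p) =
        ∫⁻ x, ENNReal.ofReal (gauge (polarMomentBody p K) (g' x) ^ p) :=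
      lintegral_congr_ae (by filter_upwards [hgg'] with x hx; rw [hx])
    simp_rw [h1, gagliardo_congr hff']
    exact hg'.tendsto_gagliardo_gauge hn hf'm hg'm (hfp.ae_eq hff') (hgp.ae_eq hgg') hp hc hK h0
  refine ⟨fun K hsymm hne => main K K.convex K.isCompact
    (K.convex.mem_nhds_zero_of_symmetric hsymm hne), fun e he => ?_⟩
  have h1 := (main (Metric.closedBall 0 1) (convex_closedBall 0 1) (isCompact_closedBall 0 1)
    (Metric.closedBall_mem_nhds 0 one_pos)).2
  have h2 : gauge (Metric.closedBall (0 : Rn n) 1) = fun z => ‖z‖ := by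
    ext z
    rw [gauge_closedBall zero_le_one, div_one]
  have h3 : ∫⁻ x, ENNReal.ofReal
      (gauge (polarMomentBody p (Metric.closedBall (0 : Rn n) 1)) (g x) ^ p) =
      ENNReal.ofReal (1 / p * ∫ u : Metric.sphere (0 : Rn n) 1, |⟪e, (u : Rn n)⟫| ^ p
        ∂(volume : Measure (Rn n)).toSphere) * ∫⁻ x, ENNReal.ofReal (‖g x‖ ^ p) := by
    rw [← lintegral_const_mul' _ _ ENNReal.ofReal_ne_top]
    congr 1 with x
    rw [gauge_polarMomentBody_rpow hp, polarMomentPow_closedBall he,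
      ENNReal.ofReal_mul (by positivity), polarMomentPow_closedBall_eq_toSphere hn hp0, mul_comm]
  rwa [h2, h3] at h1
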